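/- **Model.** A fully-parallel Thompson circuit with $n$ inputs and $k$ binary outputs is laid out on the plane divided into unit grid squares. Each node occupies one square, different nodes occupy different squares, and a wire joins two nodes along a sequence of squares, each sharing a side with the next. A wire does not pass through the square of a node other than its two ends, and each side of a grid square is crossed at most once, by at most one wire (so wires may cross, and a node has at most four wires). Each of the $n$ inputs has its own input node, and each of the $k$ outputs has its own output node; a node may be both. All inputs are present at their input nodes at the start. In each clock cycle every wire carries one bit in each direction, sent by a node on the basis of its current state, and each node updates its state as an arbitrary function of its old state and the bits it receives. After $T$ clock cycles the outputs are read off the output nodes. The area $A$ is the number of grid squares occupied by nodes or wires, and the energy is $E=AT$. A fully-parallel decoding scheme is a sequence of such circuits $D_1,D_2,\dots$ with block lengths (numbers of inputs) $n_1<n_2<\cdots$ and numbers of decoded bits (outputs) $k=k(n_1),k(n_2),\dots$, together with encoding functions $\{0,1\}^{k}\to\{0,1\}^{n}$. Let $0<\epsilon<1$. The source consists of $k$ independent fair bits; it is encoded and sent by $n$ independent uses of the binary erasure channel with erasure probability $\epsilon$, and the decoder receives the channel output in $\{0,1,\text{erasure}\}^n$. The block error probability $P_{\mathrm e}(n)$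 is the probability that the output of the decoder of block length $n$ differs from the source word. For $f:\{1,2,\dots\}\to(0,\infty)$, the scheme is an $f(n)$-decoding scheme if $P_{\mathrm e}(n)<f(n)$ for all sufficiently large block lengths $n$ of the scheme. **Theorem.** Let $0<\epsilon<1$, and let $f:\{1,2,\dots\}\to(0,\infty)$ decrease monotonically to $0$ with $\lim_{n\to\infty}\frac{-\ln f(n)}{n}=0$. Then every fully-parallel $f(n)$-decoding scheme for the binary erasure channel with erasure probability $\epsilon$ satisfies, for all sufficiently large block lengths $n$ of the scheme, $$E=AT\ \ge\ c_3\sqrt{\frac{\ln f(n)}{\ln\epsilon}}\;k ,\qquad c_3=\frac{\sqrt{\ln 2}\,(\sqrt2-1)}{16\sqrt2},$$ and $$AT^2\ \ge\ c_4\,\frac{k^2\ln f(n)}{n\ln\epsilon},\qquad c_4=\frac{\ln 2\,(\sqrt2-1)^2}{512},$$ where $A$, $T$ and $k$ are the area, the number of clock cycles and the number of decoded bits of the decoder of block length $n$. -/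

import Mathlib

open Filter Topology

namespace Thompson

/-- The unit grid squares of the plane, indexed by `ℤ × ℤ`; two squares are adjacent when they
share a side. An edge of this graph is thus a side of a grid square. -/
def grid : SimpleGraph (ℤ × ℤ) where
  Adj p q := |p.1 - q.1| + |p.2 - q.2| = 1
  symm := ⟨fun p q h => by rwa [abs_sub_comm q.1, abs_sub_comm q.2]⟩
  loopless := ⟨fun p h => by simp at h⟩

/-- A fully-parallel circuit in the Thompson model, with `n` inputs from the alphabet `α` and `k`
binary outputs: a planar layout together with a synchronous computation on it.

A node occupies one grid square. A wire joins two nodes along a sequence of grid squares, each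
sharing a side with the next; it does not run over other nodes, and every side of a grid square is
crossed at most once, by at most one wire. So two wires may meet in a square that holds no node, and
a node has at most four wires. In every clock cycle a wire carries one bit in each direction.

Nodes may be arbitrarily powerful: `State` is any type, and `init`, `send`, `step`, `read` are any
functions. -/
structure FullyParallelCircuit (α : Type) (n k : ℕ) where
  Node : Type
  Wire : Type
  [fintypeNode : Fintype Node]
  [fintypeWire : Fintype Wire]
  /-- the grid square of a node -/
  pos : Node → ℤ × ℤ
  pos_injective : Function.Injective pos
  /-- the two ends of a wire -/
  src : Wire → Node
  dst : Wire → Node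
  /-- the grid squares along a wire -/
  route : (w : Wire) → grid.Walk (pos (src w)) (pos (dst w))
  route_isTrail : ∀ w, (route w).IsTrail
  route_avoids : ∀ w v, pos v ∈ (route w).support → v = src w ∨ v = dst w
  route_disjoint : ∀ w w', w ≠ w' → (route w).edges.Disjoint (route w').edges
  /-- every input has an input node of its own -/
  inNode : Fin n → Node
  inNode_injective : Function.Injective inNode
  /-- every output has an output node of its own, which may also be an input node -/
  outNode : Fin k → Node
  outNode_injective : Function.Injective outNode
  State : Type
  /-- initial state of a node: it depends on `some a` at an input node with input `a`, and on
  `none` at the other nodes -/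
  init : Node → Option α → State
  /-- the bit that a node puts on a wire -/
  send : Node → State → Wire → Bool
  /-- the new state of a node, given its old state and the bits received on its wires -/
  step : Node → State → (Wire → Bool) → State
  /-- the output bit shown by a node -/
  read : Node → State → Bool
  /-- the number `T` of clock cycles -/
  cycles : ℕ

namespace FullyParallelCircuit

attribute [instance] fintypeNode fintypeWire

variable {α : Type} {n k : ℕ}

/-- The area: the number of grid squares occupied by nodes or wires. -/
def area (C : FullyParallelCircuit α n k) : ℕ :=
  (Finset.univ.image C.pos ∪ Finset.univ.biUnion fun w => (C.route w).support.toFinset).card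

open Classical in
/-- The bits that node `v` receives in one clock cycle when the nodes are in the states `s`: on each
of its wires, the bit sent from the other end; on wires not attached to `v`, the constant `false`. -/
noncomputable def received (C : FullyParallelCircuit α n k) (s : C.Node → C.State) (v : C.Node)
    (w : C.Wire) : Bool :=
  if C.src w = v then C.send (C.dst w) (s (C.dst w)) w
  else if C.dst w = v then C.send (C.src w) (s (C.src w)) w
  else false

/-- The states of the nodes after `t` clock cycles on the input `y`. -/
noncomputable def stateAt (C : FullyParallelCircuit α n k) (y : Fin n → α) :
    ℕ → C.Node → C.State
  | 0, v => C.init v (Function.extend C.inNode (fun i => some (y i)) (fun _ => none) v)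
  | t + 1, v => C.step v (stateAt C y t v) (C.received (stateAt C y t) v)

/-- The function computed by the circuit. -/
noncomputable def compute (C : FullyParallelCircuit α n k) (y : Fin n → α) : Fin k → Bool :=
  fun j => C.read (C.outNode j) (C.stateAt y C.cycles (C.outNode j))

/-- The Thompson energy `E = A T`. -/
def energy (C : FullyParallelCircuit α n k) : ℕ := C.area * C.cycles

end FullyParallelCircuit

/-- Transition probabilities of the binary erasure channel with erasure probability `ε`; the output
`none` is an erasure. -/
def erasureChannel (ε : ℝ) (x : Bool) : Option Bool → ℝ
  | none => ε
  | some b => if b = x then 1 - ε else 0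

/-- The probability that `dec` fails to return the source word, when the source is `k` independent
fair bits, encoded by `enc` and sent by `n` independent uses of the binary erasure channel. -/
noncomputable def blockErrorProb {n k : ℕ} (ε : ℝ) (enc : (Fin k → Bool) → Fin n → Bool)
    (dec : (Fin n → Option Bool) → Fin k → Bool) : ℝ :=
  ∑ x : Fin k → Bool, (1 / 2 : ℝ) ^ k *
    ∑ y : Fin n → Option Bool,
      (∏ i, erasureChannel ε (enc x i) (y i)) * (if dec y = x then 0 else 1)

/-- A fully-parallel decoding scheme: an infinite sequence of decoder circuits with increasing block
lengths, together with their codes. -/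
structure DecodingScheme where
  /-- block lengths -/
  n : ℕ → ℕ
  n_strictMono : StrictMono n
  /-- numbers of bits decoded -/
  k : ℕ → ℕ
  encoder : (i : ℕ) → (Fin (k i) → Bool) → Fin (n i) → Bool
  decoder : (i : ℕ) → FullyParallelCircuit (Option Bool) (n i) (k i)

namespace DecodingScheme

/-- Block error probability of the `i`-th decoder. -/
noncomputable def errorProb (D : DecodingScheme) (ε : ℝ) (i : ℕ) : ℝ :=
  blockErrorProb ε (D.encoder i) (D.decoder i).compute

/-- `D` is an `f(n)`-decoding scheme for the binary erasure channel with erasure probability `ε`: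
for sufficiently large block length `n`, the block error probability is less than `f n`. -/
def IsDecodingSchemeFor (D : DecodingScheme) (ε : ℝ) (f : ℕ → ℝ) : Prop :=
  ∀ᶠ i in atTop, D.errorProb ε i < f (D.n i)

end DecodingScheme

/-- A sublinear function. -/
def Sublinear (g : ℕ → ℝ) : Prop := Tendsto (fun n : ℕ => g n / n) atTop (𝓝 0)

end Thompson

/-!
Let `R` be a set of nodes that contains at most `L` input nodes. With probability at least `ε ^ L`
all inputs in `R` are erased, and then whatever the nodes of `R` know about the source word has
crossed the boundary of `R`, at one bit per boundary wire and clock cycle. If `R` has more output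
nodes than that, at most half of the source words are decoded correctly, so the error probability
is at least `ε ^ L / 2`. Hence, when it is smaller, every such `R` has at most `T` output nodes per
boundary wire.

Now cut the plane into regions with at most `L` inputs each: divide it into vertical strips of
width `w`, order the squares by strip and within a strip by row, and cut after every `L`-th input.
A cut within a strip is a staircase of at most `w + 1` sides, and by averaging over the offset of
the strips, at most `A / w` sides between them matter. For `w ≈ √(A L / n)` the regions are
separated by `O(√(A n / L))` sides, so that `k = O(T √(A n / L))`. The choice
`L ≈ ln (2 f(n)) / ln ε` gives the bound on `A T²`, and the bound on `A T` follows because `n ≤ A`.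
-/

namespace Thompson

namespace FullyParallelCircuit

variable {α : Type} {n k : ℕ} (C : FullyParallelCircuit α n k)

section InformationFlow

variable (R : Set C.Node) [DecidablePred (· ∈ R)]

/-- The wires on the boundary of a set `R` of nodes, through which information can enter `R`: those
with exactly one end in `R`. -/
def cutWires : Finset C.Wire :=
  {w | ¬ (C.src w ∈ R ↔ C.dst w ∈ R)}

/-- The node outside `R` from which a cut wire leads into `R`. On wires that are not cut it is just
some end of the wire. -/
def outerEnd (w : C.Wire) : C.Node :=
  if C.src w ∈ R then C.dst w else C.src w

/-- The transcript of the communication into `R` on the input `y`: the bit that enters `R` through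
each cut wire in each clock cycle. -/
noncomputable def transcript (y : Fin n → α) (q : Fin C.cycles × C.cutWires R) : Bool :=
  C.send (C.outerEnd R q.2) (C.stateAt y q.1 (C.outerEnd R q.2)) q.2

variable {C R} {y y' : Fin n → α}

theorem received_eq_of_transcript_eq (htr : C.transcript R y = C.transcript R y') {t : ℕ}
    (ht : t < C.cycles) (hst : ∀ v ∈ R, C.stateAt y t v = C.stateAt y' t v) {v : C.Node}
    (hv : v ∈ R) : C.received (C.stateAt y t) v = C.received (C.stateAt y' t) v := by
  funext w
  have hcut (hw : w ∈ C.cutWires R) :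
      C.send (C.outerEnd R w) (C.stateAt y t (C.outerEnd R w)) w =
        C.send (C.outerEnd R w) (C.stateAt y' t (C.outerEnd R w)) w :=
    congrFun htr (⟨t, ht⟩, ⟨w, hw⟩)
  simp only [cutWires, Finset.mem_filter_univ] at hcut
  unfold received
  split_ifs with hsrc hdst
  · have hs : C.src w ∈ R := hsrc ▸ hv
    by_cases hd : C.dst w ∈ R
    · rw [hst _ hd]
    · simpa only [outerEnd, if_pos hs] using hcut (by tauto)
  · have hd : C.dst w ∈ R := hdst ▸ hv
    by_cases hs : C.src w ∈ R
    · rw [hst _ hs]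
    · simpa only [outerEnd, if_neg hs] using hcut (by tauto)
  · rfl

theorem stateAt_eq_of_transcript_eq (hin : ∀ i, C.inNode i ∈ R → y i = y' i)
    (htr : C.transcript R y = C.transcript R y') {t : ℕ} (ht : t ≤ C.cycles) :
    ∀ v ∈ R, C.stateAt y t v = C.stateAt y' t v := by
  induction t with
  | zero =>
    intro v hv
    simp only [stateAt]
    by_cases hinput : ∃ i, C.inNode i = v
    · obtain ⟨i, rfl⟩ := hinput
      simp only [C.inNode_injective.extend_apply, hin i hv]
    · simp only [Function.extend_apply' _ _ _ hinput]
  | succ t ih =>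
    have hst := ih (Nat.le_of_succ_le ht)
    intro v hv
    simp only [stateAt, hst v hv, received_eq_of_transcript_eq htr ht hst hv]

theorem compute_eq_of_transcript_eq (hin : ∀ i, C.inNode i ∈ R → y i = y' i)
    (htr : C.transcript R y = C.transcript R y') {j : Fin k} (hj : C.outNode j ∈ R) :
    C.compute y j = C.compute y' j := by
  simp only [compute, stateAt_eq_of_transcript_eq hin htr le_rfl _ hj]

variable (C R)

/- A correctly decoded word is determined by its letters outside `R` together with the transcript,
because the inputs inside `R` carry no information about it. -/
theorem card_decoded_le (Y : (Fin k → Bool) → Fin n → α)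
    (hY : ∀ x x' i, C.inNode i ∈ R → Y x i = Y x' i) :
    Finset.card {x | C.compute (Y x) = x} ≤
      2 ^ (C.cycles * (C.cutWires R).card + Finset.card {j | C.outNode j ∉ R}) := by
  classical
  let code (x : Fin k → Bool) : (Fin C.cycles × C.cutWires R → Bool) ×
      ({j // C.outNode j ∉ R} → Bool) := (C.transcript R (Y x), fun j => x j)
  have hcode : Set.InjOn code (Finset.filter (fun x => C.compute (Y x) = x) Finset.univ) := by
    intro x hx x' hx' hxx'
    rw [Finset.mem_coe, Finset.mem_filter_univ] at hx hx'
    obtain ⟨htr, hout⟩ := Prod.ext_iff.1 hxx'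
    funext j
    by_cases hj : C.outNode j ∈ R
    · rw [← hx, ← hx']
      exact compute_eq_of_transcript_eq (hY x x') htr hj
    · exact congrFun hout ⟨j, hj⟩
  have hcard := Finset.card_le_card_of_injOn (t := Finset.univ) code
    (fun _ _ => Finset.mem_univ _) hcode
  simpa only [Finset.card_univ, Fintype.card_prod, Fintype.card_fun, Fintype.card_bool,
    Fintype.card_fin, Fintype.card_coe, Fintype.card_subtype (C.outNode · ∉ R),
    ← pow_add] using hcard

theorem two_mul_card_decoded_le (Y : (Fin k → Bool) → Fin n → α)
    (hY : ∀ x x' i, C.inNode i ∈ R → Y x i = Y x' i)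
    (hR : C.cycles * (C.cutWires R).card < Finset.card {j | C.outNode j ∈ R}) :
    2 * Finset.card {x | C.compute (Y x) = x} ≤ 2 ^ k := by
  have hout : Finset.card {j | C.outNode j ∈ R} + Finset.card {j | C.outNode j ∉ R} = k := by
    simpa using Finset.card_filter_add_card_filter_not (s := Finset.univ) (C.outNode · ∈ R)
  calc 2 * Finset.card {x | C.compute (Y x) = x}
      ≤ 2 * 2 ^ (C.cycles * (C.cutWires R).card + Finset.card {j | C.outNode j ∉ R}) :=
        Nat.mul_le_mul_left 2 (C.card_decoded_le R Y hY)
    _ = 2 ^ (C.cycles * (C.cutWires R).card + Finset.card {j | C.outNode j ∉ R} + 1) :=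
        (pow_succ' ..).symm
    _ ≤ 2 ^ k := Nat.pow_le_pow_right two_pos (by omega)

end InformationFlow

end FullyParallelCircuit

section Erasures

variable {ι : Type*} [DecidableEq ι]

/-- The output of the erasure channel when the word `c` is sent and exactly the letters in the
positions `s` are erased. -/
def erase (s : Finset ι) (c : ι → Bool) : ι → Option Bool :=
  fun i => if i ∈ s then none else some (c i)

theorem erase_injective (c : ι → Bool) : Function.Injective fun s => erase s c := by
  intro s s' h
  ext i
  have := congrFun h i
  simp only [erase] at this
  split_ifs at this <;> simp_all only

theorem exists_erase_eq [Finite ι] {c : ι → Bool} {y : ι → Option Bool}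
    (h : ∀ i b, y i = some b → b = c i) : ∃ s, erase s c = y := by
  refine ⟨(Set.toFinite {i | y i = none}).toFinset, funext fun i => ?_⟩
  cases hy : y i with
  | none => simp [erase, hy]
  | some b => simp [erase, hy, h i b hy]

variable [Fintype ι]

theorem sum_superset_pow_mul_pow {K : Type*} [CommSemiring K] (I : Finset ι) (p q : K) :
    ∑ s with I ⊆ s, p ^ s.card * q ^ sᶜ.card = p ^ I.card * (p + q) ^ Iᶜ.card := by
  calc ∑ s with I ⊆ s, p ^ s.card * q ^ sᶜ.card
      = ∑ s : Finset ι, (∏ _i ∈ s, p) * ∏ i ∈ sᶜ, if i ∈ I then 0 else q := by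
        rw [Finset.sum_filter]
        refine Finset.sum_congr rfl fun s _ => ?_
        rw [Finset.prod_const]
        split_ifs with hI
        · rw [Finset.prod_congr rfl fun i hi =>
            if_neg fun hiI => Finset.mem_compl.1 hi (hI hiI), Finset.prod_const]
        · obtain ⟨i, hiI, his⟩ := Finset.not_subset.1 hI
          have hzero : ∏ i ∈ sᶜ, (if i ∈ I then 0 else q) = 0 :=
            Finset.prod_eq_zero (Finset.mem_compl.2 his) (if_pos hiI)
          rw [hzero, mul_zero]
    _ = ∏ i, (p + if i ∈ I then 0 else q) := by
        simp only [Finset.prod_add, Finset.powerset_univ, Finset.compl_eq_univ_sdiff]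
    _ = ∏ i, if i ∈ I then p else p + q :=
        Finset.prod_congr rfl fun i _ => by split_ifs <;> simp only [add_zero]
    _ = p ^ I.card * (p + q) ^ Iᶜ.card := by
        simp [Finset.prod_ite, ← Finset.compl_filter]

theorem prod_erasureChannel_erase (ε : ℝ) (s : Finset ι) (c : ι → Bool) :
    ∏ i, erasureChannel ε (c i) (erase s c i) = ε ^ s.card * (1 - ε) ^ sᶜ.card := by
  have hfactor (i : ι) :
      erasureChannel ε (c i) (erase s c i) = if i ∈ s then ε else 1 - ε := by
    simp only [erase]
    split_ifs <;> simp only [erasureChannel, if_true]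
  simp [hfactor, Finset.prod_ite, ← Finset.compl_filter]

theorem sum_prod_erasureChannel_mul (ε : ℝ) (c : ι → Bool) (g : (ι → Option Bool) → ℝ) :
    ∑ y, (∏ i, erasureChannel ε (c i) (y i)) * g y =
      ∑ s : Finset ι, ε ^ s.card * (1 - ε) ^ sᶜ.card * g (erase s c) := by
  refine (Fintype.sum_of_injective _ (erase_injective c) _ _ (fun y hy => ?_) fun s => ?_).symm
  · have hflip : ∃ i b, y i = some b ∧ b ≠ c i := by
      contrapose! hy
      exact exists_erase_eq hy
    obtain ⟨i, b, hyi, hb⟩ := hflip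
    rw [Finset.prod_eq_zero (Finset.mem_univ i), zero_mul]
    simp only [erasureChannel, hyi, if_neg hb]
  · rw [prod_erasureChannel_erase]

end Erasures

section BlockErrorProb

variable {n k : ℕ} {ε : ℝ} {enc : (Fin k → Bool) → Fin n → Bool}
  {dec : (Fin n → Option Bool) → Fin k → Bool}

theorem blockErrorProb_eq_sum_erasures : blockErrorProb ε enc dec =
    ∑ s : Finset (Fin n), ε ^ s.card * (1 - ε) ^ sᶜ.card *
      (Finset.card {x | dec (erase s (enc x)) ≠ x} / 2 ^ k) := by
  simp only [blockErrorProb, sum_prod_erasureChannel_mul, Finset.mul_sum]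
  rw [Finset.sum_comm]
  refine Finset.sum_congr rfl fun s _ => ?_
  simp only [← ite_not (dec _ = _), Finset.natCast_card_filter, Finset.sum_div, Finset.mul_sum,
    one_div, inv_pow]
  exact Finset.sum_congr rfl fun x _ => by ring

theorem pow_card_mul_le_blockErrorProb (hε0 : 0 ≤ ε) (hε1 : ε ≤ 1) (I : Finset (Fin n)) {c : ℝ}
    (hc : ∀ s, I ⊆ s → c * 2 ^ k ≤ Finset.card {x | dec (erase s (enc x)) ≠ x}) :
    ε ^ I.card * c ≤ blockErrorProb ε enc dec := by
  have hprob (s : Finset (Fin n)) : 0 ≤ ε ^ s.card * (1 - ε) ^ sᶜ.card :=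
    mul_nonneg (pow_nonneg hε0 _) (pow_nonneg (sub_nonneg.2 hε1) _)
  calc ε ^ I.card * c
      = ∑ s with I ⊆ s, ε ^ s.card * (1 - ε) ^ sᶜ.card * c := by
        rw [← Finset.sum_mul, sum_superset_pow_mul_pow, add_sub_cancel, one_pow, mul_one]
    _ ≤ ∑ s with I ⊆ s, ε ^ s.card * (1 - ε) ^ sᶜ.card *
          (Finset.card {x | dec (erase s (enc x)) ≠ x} / 2 ^ k) := by
        refine Finset.sum_le_sum fun s hs => mul_le_mul_of_nonneg_left ?_ (hprob s)
        rw [le_div_iff₀ (by positivity)]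
        exact hc s ((Finset.mem_filter_univ s).1 hs)
    _ ≤ blockErrorProb ε enc dec := by
        rw [blockErrorProb_eq_sum_erasures]
        exact Finset.sum_le_univ_sum_of_nonneg fun s => mul_nonneg (hprob s) (by positivity)

theorem blockErrorProb_nonneg (hε0 : 0 ≤ ε) (hε1 : ε ≤ 1) : 0 ≤ blockErrorProb ε enc dec := by
  simpa using pow_card_mul_le_blockErrorProb (enc := enc) (dec := dec) hε0 hε1 ∅ (c := 0) (by simp)

theorem card_outputs_le_of_blockErrorProb_lt {C : FullyParallelCircuit (Option Bool) n k}
    (hε0 : 0 ≤ ε) (hε1 : ε ≤ 1) (R : Set C.Node) [DecidablePred (· ∈ R)]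
    (hP : blockErrorProb ε enc C.compute < ε ^ (Finset.card {i | C.inNode i ∈ R}) / 2) :
    Finset.card {j | C.outNode j ∈ R} ≤ C.cycles * (C.cutWires R).card := by
  by_contra! hR
  refine hP.not_ge (pow_card_mul_le_blockErrorProb hε0 hε1 _ fun s hs => ?_)
  have hdecoded : 2 * Finset.card {x | C.compute (erase s (enc x)) = x} ≤ 2 ^ k :=
    C.two_mul_card_decoded_le R _ (fun x x' i hi => by
      simp only [erase, if_pos (hs ((Finset.mem_filter_univ i).2 hi))]) hR
  have htotal : Finset.card {x | C.compute (erase s (enc x)) = x} +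
      Finset.card {x | C.compute (erase s (enc x)) ≠ x} = 2 ^ k := by
    simpa using Finset.card_filter_add_card_filter_not (s := Finset.univ)
      fun x => C.compute (erase s (enc x)) = x
  have hundecoded : 2 ^ k ≤ 2 * Finset.card {x | C.compute (erase s (enc x)) ≠ x} := by omega
  have : (2 ^ k : ℝ) ≤ 2 * Finset.card {x | C.compute (erase s (enc x)) ≠ x} := mod_cast hundecoded
  linarith

end BlockErrorProb

section Rank

variable {ι K : Type*} [Fintype ι] [LinearOrder K] {a : ι → K}

/-- The number of members of the family `a` that lie strictly below `c`. Dividing it by `L` groups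
an injective family into blocks of `L` consecutive members. -/
def rank (a : ι → K) (c : K) : ℕ := Finset.card {i | a i < c}

theorem rank_mono : Monotone (rank a) := fun _ _ hcd =>
  Finset.card_le_card (Finset.monotone_filter_right _ fun _ _ hi => hi.trans_le hcd)

theorem rank_apply_lt_rank {i : ι} {c : K} (h : a i < c) : rank a (a i) < rank a c := by
  refine Finset.card_lt_card (Finset.ssubset_iff_of_subset ?_ |>.2 ⟨i, ?_, ?_⟩)
  · exact Finset.monotone_filter_right _ fun _ _ hj => hj.trans h
  · simpa using h
  · simp

theorem rank_le_card (c : K) : rank a c ≤ Fintype.card ι :=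
  Finset.card_le_univ _

theorem rank_apply_lt_card (i : ι) : rank a (a i) < Fintype.card ι :=
  Finset.card_lt_univ_of_notMem (x := i) (by simp)

theorem rank_apply_injective (ha : Function.Injective a) :
    Function.Injective fun i => rank a (a i) := by
  intro i j hij
  by_contra hne
  rcases lt_or_gt_of_ne (ha.ne hne) with h | h
  · exact (rank_apply_lt_rank h).ne hij
  · exact (rank_apply_lt_rank h).ne' hij

theorem image_rank_apply (ha : Function.Injective a) :
    Finset.univ.image (fun i => rank a (a i)) = Finset.range (Fintype.card ι) := by
  refine Finset.eq_of_subset_of_card_le ?_ ?_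
  · exact Finset.image_subset_iff.2 fun i _ => Finset.mem_range.2 (rank_apply_lt_card i)
  · rw [Finset.card_image_of_injective _ (rank_apply_injective ha), Finset.card_range,
      Finset.card_univ]

theorem card_filter_rank_apply (ha : Function.Injective a) (p : ℕ → Prop) [DecidablePred p] :
    Finset.card {i | p (rank a (a i))} = ((Finset.range (Fintype.card ι)).filter p).card := by
  rw [← image_rank_apply ha, Finset.filter_image,
    Finset.card_image_of_injective _ (rank_apply_injective ha)]

theorem card_rank_div_eq_le (ha : Function.Injective a) {L : ℕ} (hL : 0 < L) (m : ℕ) :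
    Finset.card {i | rank a (a i) / L = m} ≤ L := by
  rw [card_filter_rank_apply ha (· / L = m)]
  calc ((Finset.range (Fintype.card ι)).filter (· / L = m)).card
      ≤ (Finset.Ico (m * L) (m * L + L)).card := by
        refine Finset.card_le_card fun j hj => ?_
        have := (Nat.div_eq_iff hL).1 (Finset.mem_filter.1 hj).2
        rw [Finset.mem_Ico]
        omega
    _ = L := by rw [Nat.card_Ico, Nat.add_sub_cancel_left]

theorem card_dvd_rank_add_one (ha : Function.Injective a) (L : ℕ) :
    Finset.card {i | L ∣ rank a (a i) + 1} = Fintype.card ι / L := by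
  rw [card_filter_rank_apply ha (L ∣ · + 1), Nat.card_multiples]

theorem exists_dvd_rank_add_one_of_div_lt_div (ha : Function.Injective a) {L : ℕ} {c d : K}
    (h : rank a c / L < rank a d / L) : ∃ i, L ∣ rank a (a i) + 1 ∧ c ≤ a i ∧ a i < d := by
  have hL : 0 < L := Nat.pos_of_ne_zero fun h0 => by simp [h0] at h
  set q := rank a d / L
  have hc : rank a c < q * L := (Nat.div_lt_iff_lt_mul hL).1 h
  have hd : q * L ≤ rank a d := Nat.div_mul_le_self _ _
  have hlast : q * L - 1 ∈ Finset.range (Fintype.card ι) := by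
    have := rank_le_card (a := a) d
    rw [Finset.mem_range]
    omega
  rw [← image_rank_apply ha, Finset.mem_image] at hlast
  obtain ⟨i, -, hi⟩ := hlast
  refine ⟨i, ⟨q, by lia⟩, le_of_not_gt fun hic => ?_, lt_of_not_ge fun hdi => ?_⟩
  · have := rank_apply_lt_rank hic
    omega
  · have := rank_mono (a := a) hdi
    omega

end Rank

section Strips

variable {w : ℕ} {r : ℤ} {p q t : ℤ × ℤ}

/-- The number of the vertical strip that contains the column `x`, when the plane is divided into
strips of width `w` whose last columns are those congruent to `r` modulo `w`. -/
def strip (w : ℕ) (r x : ℤ) : ℤ := (x - r - 1) / w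

theorem strip_mono : Monotone (strip w r) := fun x y h => by
  rcases w.eq_zero_or_pos with rfl | hw
  · simp [strip]
  · exact Int.ediv_le_ediv (mod_cast hw) (by omega)

theorem strip_add_one (hw : 0 < w) {x : ℤ} (hx : ¬ (w : ℤ) ∣ x - r) :
    strip w r (x + 1) = strip w r x := by
  have hw' : (0 : ℤ) < w := mod_cast hw
  have hpos : 0 < (x - r) % w :=
    (Int.emod_nonneg _ hw'.ne').lt_of_ne' fun h => hx (Int.dvd_of_emod_eq_zero h)
  have hlt : (x - r) % w < w := Int.emod_lt_of_pos _ hw'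
  have hdiv : (x - r) % w + w * ((x - r) / w) = x - r := Int.emod_add_mul_ediv _ _
  unfold strip
  rw [show x + 1 - r - 1 = x - r by ring, eq_comm, Int.ediv_eq_iff_of_pos hw']
  constructor <;> linarith

/-- The columns of the strip with number `b`. -/
noncomputable def stripColumns (w : ℕ) (r b : ℤ) : Finset ℤ :=
  Finset.Ico (b * w + r + 1) (b * w + r + 1 + w)

theorem mem_stripColumns (hw : 0 < w) {x b : ℤ} : x ∈ stripColumns w r b ↔ strip w r x = b := by
  rw [stripColumns, strip, Finset.mem_Ico, Int.ediv_eq_iff_of_pos (mod_cast hw)]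
  constructor <;> rintro ⟨_, _⟩ <;> constructor <;> linarith

/-- Sorting key for grid squares: by strip, within a strip by row, within a row by column. -/
def stripKey (w : ℕ) (r : ℤ) (p : ℤ × ℤ) : ℤ ×ₗ ℤ ×ₗ ℤ :=
  toLex (strip w r p.1, toLex (p.2, p.1))

theorem stripKey_injective : Function.Injective (stripKey w r) := by
  intro p q h
  simp only [stripKey, EmbeddingLike.apply_eq_iff_eq, Prod.mk.injEq] at h
  exact Prod.ext h.2.2 h.2.1

theorem stripKey_lt : stripKey w r p < stripKey w r q ↔
    strip w r p.1 < strip w r q.1 ∨ strip w r p.1 = strip w r q.1 ∧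
      (p.2 < q.2 ∨ p.2 = q.2 ∧ p.1 < q.1) := by
  simp only [stripKey, Prod.Lex.toLex_lt_toLex]

theorem stripKey_le : stripKey w r p ≤ stripKey w r q ↔
    strip w r p.1 < strip w r q.1 ∨ strip w r p.1 = strip w r q.1 ∧
      (p.2 < q.2 ∨ p.2 = q.2 ∧ p.1 ≤ q.1) := by
  simp only [stripKey, Prod.Lex.toLex_le_toLex]

theorem stripKey_lt_right (p : ℤ × ℤ) : stripKey w r p < stripKey w r (p.1 + 1, p.2) := by
  have := (strip_mono (w := w) (r := r) (Int.le_add_one le_rfl : p.1 ≤ p.1 + 1)).lt_or_eq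
  rw [stripKey_lt]
  dsimp only
  omega

theorem stripKey_lt_up (p : ℤ × ℤ) : stripKey w r p < stripKey w r (p.1, p.2 + 1) := by
  rw [stripKey_lt]
  dsimp only
  omega

theorem grid_adj_iff : grid.Adj p q ↔
    q = (p.1 + 1, p.2) ∨ p = (q.1 + 1, q.2) ∨ q = (p.1, p.2 + 1) ∨ p = (q.1, q.2 + 1) := by
  change |p.1 - q.1| + |p.2 - q.2| = 1 ↔ _
  simp only [Prod.ext_iff]
  grind

theorem eq_right_or_eq_up_of_adj (h : grid.Adj p q) (hpq : stripKey w r p < stripKey w r q) :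
    q = (p.1 + 1, p.2) ∨ q = (p.1, p.2 + 1) := by
  rcases grid_adj_iff.1 h with h | h | h | h
  · exact .inl h
  · exact absurd hpq (h ▸ (stripKey_lt_right q).not_gt)
  · exact .inr h
  · exact absurd hpq (h ▸ (stripKey_lt_up q).not_gt)

/-- The side between a square and its right neighbour. -/
def rightSide (p : ℤ × ℤ) : Sym2 (ℤ × ℤ) := s(p, (p.1 + 1, p.2))

/-- The side between a square and its upper neighbour. -/
def upperSide (p : ℤ × ℤ) : Sym2 (ℤ × ℤ) := s(p, (p.1, p.2 + 1))

/-- The sides inside the strip of the square `t` that separate the squares up to `t` from those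
after `t` in the order of `stripKey`: they form a staircase across the strip, with its step to the
right of `t`. -/
noncomputable def staircase (w : ℕ) (r : ℤ) (t : ℤ × ℤ) : Finset (Sym2 (ℤ × ℤ)) :=
  insert (rightSide t) ((stripColumns w r (strip w r t.1)).image fun x =>
    upperSide (x, if x ≤ t.1 then t.2 else t.2 - 1))

theorem card_staircase_le (w : ℕ) (r : ℤ) (t : ℤ × ℤ) : (staircase w r t).card ≤ w + 1 := by
  refine (Finset.card_insert_le _ _).trans (Nat.add_le_add_right ?_ 1)
  refine Finset.card_image_le.trans_eq ?_
  rw [stripColumns, Int.card_Ico, add_sub_cancel_left, Int.toNat_natCast]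

theorem eq_of_stripKey_le_of_lt_right (hw : 0 < w) (hp : ¬ (w : ℤ) ∣ p.1 - r)
    (hpt : stripKey w r p ≤ stripKey w r t) (htp : stripKey w r t < stripKey w r (p.1 + 1, p.2)) :
    t = p := by
  rw [stripKey_le] at hpt
  rw [stripKey_lt, strip_add_one hw hp] at htp
  ext <;> omega

theorem upperSide_mem_staircase (hw : 0 < w) (hpt : stripKey w r p ≤ stripKey w r t)
    (htp : stripKey w r t < stripKey w r (p.1, p.2 + 1)) : upperSide p ∈ staircase w r t := by
  rw [stripKey_le] at hpt
  rw [stripKey_lt] at htp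
  dsimp only at htp
  refine Finset.mem_insert_of_mem (Finset.mem_image.2 ⟨p.1, ?_, ?_⟩)
  · rw [mem_stripColumns hw]
    omega
  · congr
    split_ifs <;> omega

theorem side_mem_of_separated (hw : 0 < w) (h : grid.Adj p q)
    (hpt : stripKey w r p ≤ stripKey w r t) (htq : stripKey w r t < stripKey w r q) :
    (s(p, q) = rightSide p ∧ (w : ℤ) ∣ p.1 - r) ∨ s(p, q) ∈ staircase w r t := by
  rcases eq_right_or_eq_up_of_adj h (hpt.trans_lt htq) with rfl | rfl
  · by_cases hp : (w : ℤ) ∣ p.1 - r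
    · exact .inl ⟨rfl, hp⟩
    · obtain rfl := eq_of_stripKey_le_of_lt_right hw hp hpt htq
      exact .inr (Finset.mem_insert_self _ _)
  · exact .inr (upperSide_mem_staircase hw hpt htq)

end Strips

section Regions

theorem exists_mul_card_filter_dvd_sub_le {α : Type*} (S : Finset α) (f : α → ℤ) {w : ℕ}
    (hw : 0 < w) : ∃ r : ℤ, w * (S.filter fun p => (w : ℤ) ∣ f p - r).card ≤ S.card := by
  have : NeZero w := ⟨hw.ne'⟩
  have hw' : (0 : ℚ) < w := mod_cast hw
  have havg : (S.card : ℚ) ≤ (Finset.univ : Finset (ZMod w)).card • (S.card / w : ℚ) := by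
    rw [Finset.card_univ, ZMod.card, nsmul_eq_mul, mul_div_cancel₀ _ hw'.ne']
  obtain ⟨r, -, hr⟩ := Finset.exists_card_fiber_le_of_card_le_nsmul
    (f := fun p => (f p : ZMod w)) Finset.univ_nonempty havg
  obtain ⟨r, rfl⟩ := ZMod.intCast_surjective r
  simp only [eq_comm (b := (r : ZMod w)), ZMod.intCast_eq_intCast_iff_dvd_sub] at hr
  rw [le_div_iff₀' hw'] at hr
  exact ⟨r, mod_cast hr⟩

variable {ι : Type*} [Fintype ι] {pt : ι → ℤ × ℤ}

/-- `E` contains every side between two squares of `S` that lie in different regions, where the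
regions are the fibres of `ρ`. -/
def SeparatesRegions (S : Finset (ℤ × ℤ)) (ρ : ℤ × ℤ → ℕ) (E : Finset (Sym2 (ℤ × ℤ))) : Prop :=
  ∀ p ∈ S, ∀ q ∈ S, grid.Adj p q → ρ p ≠ ρ q → s(p, q) ∈ E

theorem exists_regions_of_width (S : Finset (ℤ × ℤ)) (hpt : Function.Injective pt) {w L : ℕ}
    (hw : 0 < w) (hL : 0 < L) :
    ∃ ρ E, (∀ m, Finset.card {i | ρ (pt i) = m} ≤ L) ∧ SeparatesRegions S ρ E ∧
      w * E.card ≤ S.card + w * (Fintype.card ι / L * (w + 1)) := by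
  obtain ⟨r, hr⟩ := exists_mul_card_filter_dvd_sub_le S Prod.fst hw
  let a (i : ι) := stripKey w r (pt i)
  have ha : Function.Injective a := stripKey_injective.comp hpt
  let ρ (p : ℤ × ℤ) := rank a (stripKey w r p) / L
  let ends := (S.filter fun p => (w : ℤ) ∣ p.1 - r).image rightSide
  let stairs := Finset.biUnion {i | L ∣ rank a (a i) + 1} fun i => staircase w r (pt i)
  have hlt {p q : ℤ × ℤ} (hp : p ∈ S) (hadj : grid.Adj p q) (hρ : ρ p < ρ q) :
      s(p, q) ∈ ends ∪ stairs := by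
    obtain ⟨i, hi, hpi, hiq⟩ := exists_dvd_rank_add_one_of_div_lt_div ha hρ
    rcases side_mem_of_separated hw hadj hpi hiq with ⟨hside, hdvd⟩ | hside
    · exact Finset.mem_union_left _
        (Finset.mem_image.2 ⟨p, Finset.mem_filter.2 ⟨hp, hdvd⟩, hside.symm⟩)
    · exact Finset.mem_union_right _
        (Finset.mem_biUnion.2 ⟨i, (Finset.mem_filter_univ i).2 hi, hside⟩)
  have hends : w * ends.card ≤ S.card := (Nat.mul_le_mul_left w Finset.card_image_le).trans hr
  have hstairs : stairs.card ≤ Fintype.card ι / L * (w + 1) := by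
    rw [← card_dvd_rank_add_one ha L]
    exact Finset.card_biUnion_le_card_mul _ _ _ fun i _ => card_staircase_le w r (pt i)
  refine ⟨ρ, ends ∪ stairs, card_rank_div_eq_le ha hL, fun p hp q hq hadj hne => ?_, ?_⟩
  · rcases lt_or_gt_of_ne hne with h | h
    · exact hlt hp hadj h
    · rw [Sym2.eq_swap]
      exact hlt hq hadj.symm h
  · calc w * (ends ∪ stairs).card ≤ w * (ends.card + stairs.card) :=
          Nat.mul_le_mul_left w (Finset.card_union_le _ _)
      _ = w * ends.card + w * stairs.card := Nat.mul_add ..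
      _ ≤ S.card + w * (Fintype.card ι / L * (w + 1)) :=
          add_le_add hends (Nat.mul_le_mul_left w hstairs)

theorem exists_mul_sq_le_and_le_mul_sq {M A : ℕ} (hM : 0 < M) (hMA : M ≤ A) :
    ∃ w, 0 < w ∧ M * w ^ 2 ≤ A ∧ A ≤ 4 * (M * w ^ 2) := by
  set w := Nat.sqrt (A / M)
  have hw : 0 < w := Nat.sqrt_pos.2 (Nat.div_pos hMA hM)
  refine ⟨w, hw, (Nat.mul_le_mul_left M (Nat.sqrt_le' _)).trans (Nat.mul_div_le A M), ?_⟩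
  calc A ≤ (w + 1) ^ 2 * M := ((Nat.div_lt_iff_lt_mul hM).1 (Nat.lt_succ_sqrt' _)).le
    _ ≤ (w + w) ^ 2 * M := by gcongr; exact hw
    _ = 4 * (M * w ^ 2) := by ring

/- The width `w ≈ √(S.card / M)` balances the `S.card / w` sides between strips against the
`M * (w + 1)` sides in the staircases, where `M` is the number of cuts within strips. -/
theorem exists_regions {S : Finset (ℤ × ℤ)} (hpt : Function.Injective pt) (hS : ∀ i, pt i ∈ S)
    {L : ℕ} (hL : 0 < L) :
    ∃ ρ E, (∀ m, Finset.card {i | ρ (pt i) = m} ≤ L) ∧ SeparatesRegions S ρ E ∧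
      E.card ^ 2 ≤ 36 * (S.card * (Fintype.card ι / L)) := by
  set M := Fintype.card ι / L with hM
  rcases Nat.eq_zero_or_pos M with hM0 | hMpos
  · have hcard : Fintype.card ι ≤ L := (Nat.lt_of_div_eq_zero hL (hM.symm.trans hM0)).le
    exact ⟨fun _ => 0, ∅, fun m => (Finset.card_le_univ _).trans hcard,
      fun p _ q _ _ hne => absurd rfl hne, by simp⟩
  have hcard : Fintype.card ι ≤ S.card :=
    Finset.card_le_card_of_injOn pt (fun i _ => hS i) hpt.injOn
  obtain ⟨w, hw, hwS, hSw⟩ :=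
    exists_mul_sq_le_and_le_mul_sq hMpos ((Nat.div_le_self _ L).trans hcard)
  obtain ⟨ρ, E, hρ, hE, hcardE⟩ := exists_regions_of_width S hpt hw hL
  have hE6 : E.card ≤ 6 * (M * w) := by
    refine Nat.le_of_mul_le_mul_left ?_ hw
    calc w * E.card ≤ 4 * (M * w ^ 2) + w * (M * (w + w)) := by
          refine hcardE.trans (add_le_add hSw ?_)
          gcongr
          exact hw
      _ = w * (6 * (M * w)) := by ring
  refine ⟨ρ, E, hρ, hE, ?_⟩
  calc E.card ^ 2 ≤ (6 * (M * w)) ^ 2 := Nat.pow_le_pow_left hE6 2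
    _ = 36 * (M * w ^ 2 * M) := by ring
    _ ≤ 36 * (S.card * M) := by gcongr

end Regions

namespace FullyParallelCircuit

variable {α : Type} {n k : ℕ} (C : FullyParallelCircuit α n k)

/-- The grid squares occupied by nodes or wires, whose number is the area. -/
def squares : Finset (ℤ × ℤ) :=
  Finset.univ.image C.pos ∪ Finset.univ.biUnion fun w => (C.route w).support.toFinset

variable {C}

theorem pos_mem_squares (v : C.Node) : C.pos v ∈ C.squares :=
  Finset.mem_union_left _ (Finset.mem_image_of_mem _ (Finset.mem_univ v))

theorem mem_squares_of_mem_route {w : C.Wire} {p : ℤ × ℤ} (hp : p ∈ (C.route w).support) :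
    p ∈ C.squares :=
  Finset.mem_union_right _
    (Finset.mem_biUnion.2 ⟨w, Finset.mem_univ w, List.mem_toFinset.2 hp⟩)

theorem inputs_le_area : n ≤ C.area := by
  have hcard : (Finset.univ : Finset (Fin n)).card ≤ C.squares.card :=
    Finset.card_le_card_of_injOn (C.pos ∘ C.inNode) (fun _ _ => pos_mem_squares _)
      (C.pos_injective.comp C.inNode_injective).injOn
  rwa [Finset.card_univ, Fintype.card_fin] at hcard

section Separation

variable {ρ : ℤ × ℤ → ℕ} {E : Finset (Sym2 (ℤ × ℤ))}

theorem exists_mem_edges_of_separated (hE : SeparatesRegions C.squares ρ E) {w : C.Wire}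
    (hw : ρ (C.pos (C.src w)) ≠ ρ (C.pos (C.dst w))) : ∃ e ∈ E, e ∈ (C.route w).edges := by
  obtain ⟨d, hd, hfst, hsnd⟩ := (C.route w).exists_boundary_dart
    {p | ρ p = ρ (C.pos (C.src w))} rfl (Ne.symm hw)
  refine ⟨d.edge, ?_, List.mem_map_of_mem hd⟩
  refine hE d.fst ?_ d.snd ?_ d.adj fun h => hsnd (h.symm.trans hfst)
  · exact mem_squares_of_mem_route ((C.route w).dart_fst_mem_support_of_mem_darts hd)
  · exact mem_squares_of_mem_route ((C.route w).dart_snd_mem_support_of_mem_darts hd)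

theorem card_separated_wires_le (hE : SeparatesRegions C.squares ρ E) :
    Finset.card {w | ρ (C.pos (C.src w)) ≠ ρ (C.pos (C.dst w))} ≤ E.card := by
  refine Finset.card_le_card_of_forall_subsingleton (fun w e => e ∈ (C.route w).edges)
    (fun w hw => exists_mem_edges_of_separated hE ((Finset.mem_filter_univ w).1 hw)) ?_
  rintro e - w ⟨-, hw⟩ w' ⟨-, hw'⟩
  by_contra hne
  exact C.route_disjoint w w' hne hw hw'

theorem sum_card_cutWires_le (ρ : C.Node → ℕ) (J : Finset ℕ) :
    ∑ m ∈ J, (C.cutWires {v | ρ v = m}).card ≤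
      2 * Finset.card {w | ρ (C.src w) ≠ ρ (C.dst w)} := by
  classical
  set W : Finset C.Wire := {w | ρ (C.src w) ≠ ρ (C.dst w)}
  have hends (g : C.Wire → ℕ) : ∑ m ∈ J, (W.filter fun w => g w = m).card ≤ W.card := by
    rw [Finset.sum_card_fiberwise_eq_card_filter]
    exact Finset.card_filter_le _ _
  calc ∑ m ∈ J, (C.cutWires {v | ρ v = m}).card
      ≤ ∑ m ∈ J, ((W.filter fun w => ρ (C.src w) = m).card +
          (W.filter fun w => ρ (C.dst w) = m).card) := by
        refine Finset.sum_le_sum fun m _ => (Finset.card_le_card fun w hw => ?_).trans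
          (Finset.card_union_le _ _)
        simp only [cutWires, Set.mem_ofPred_eq, Finset.mem_filter_univ] at hw
        simp only [W, Finset.mem_union, Finset.mem_filter, Finset.mem_univ, true_and]
        grind
    _ ≤ W.card + W.card := by
        rw [Finset.sum_add_distrib]
        exact add_le_add (hends _) (hends _)
    _ = 2 * W.card := (two_mul _).symm

end Separation

end FullyParallelCircuit

section Decoder

variable {n k : ℕ} {ε : ℝ} {enc : (Fin k → Bool) → Fin n → Bool}
  {C : FullyParallelCircuit (Option Bool) n k}

theorem outputs_le_of_separatesRegions (hε0 : 0 ≤ ε) (hε1 : ε ≤ 1) {L : ℕ}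
    (hP : blockErrorProb ε enc C.compute < ε ^ L / 2) {ρ : ℤ × ℤ → ℕ}
    (hρ : ∀ m, Finset.card {i | ρ (C.pos (C.inNode i)) = m} ≤ L) {E : Finset (Sym2 (ℤ × ℤ))}
    (hE : SeparatesRegions C.squares ρ E) : k ≤ 2 * (C.cycles * E.card) := by
  let outRegion (j : Fin k) : ℕ := ρ (C.pos (C.outNode j))
  have hregion (m : ℕ) : Finset.card {j | outRegion j = m} ≤
      C.cycles * (C.cutWires {v | ρ (C.pos v) = m}).card := by
    refine card_outputs_le_of_blockErrorProb_lt hε0 hε1 {v | ρ (C.pos v) = m} (hP.trans_le ?_)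
    exact div_le_div_of_nonneg_right (pow_le_pow_of_le_one hε0 hε1 (hρ m)) two_pos.le
  calc k = ∑ m ∈ Finset.univ.image outRegion, Finset.card {j | outRegion j = m} := by
        rw [← Finset.card_eq_sum_card_image, Finset.card_univ, Fintype.card_fin]
    _ ≤ ∑ m ∈ Finset.univ.image outRegion,
          C.cycles * (C.cutWires {v | ρ (C.pos v) = m}).card :=
        Finset.sum_le_sum fun m _ => hregion m
    _ ≤ C.cycles * (2 * E.card) := by
        rw [← Finset.mul_sum]
        exact Nat.mul_le_mul_left _ ((C.sum_card_cutWires_le (fun v => ρ (C.pos v)) _).trans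
          (Nat.mul_le_mul_left 2 (C.card_separated_wires_le hE)))
    _ = 2 * (C.cycles * E.card) := Nat.mul_left_comm ..

theorem sq_outputs_mul_le (hε0 : 0 ≤ ε) (hε1 : ε ≤ 1) {L : ℕ} (hL : 0 < L)
    (hP : blockErrorProb ε enc C.compute < ε ^ L / 2) :
    k ^ 2 * L ≤ 144 * (C.area * C.cycles ^ 2 * n) := by
  obtain ⟨ρ, E, hρ, hE, hcardE⟩ := exists_regions (S := C.squares)
    (C.pos_injective.comp C.inNode_injective) (fun _ => C.pos_mem_squares _) hL
  rw [Fintype.card_fin] at hcardE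
  calc k ^ 2 * L ≤ (2 * (C.cycles * E.card)) ^ 2 * L := by
        gcongr
        exact outputs_le_of_separatesRegions hε0 hε1 hP hρ hE
    _ = 4 * C.cycles ^ 2 * E.card ^ 2 * L := by ring
    _ ≤ 4 * C.cycles ^ 2 * (36 * (C.area * (n / L))) * L := by
        gcongr
        exact hcardE
    _ = 144 * (C.area * C.cycles ^ 2 * (n / L * L)) := by ring
    _ ≤ 144 * (C.area * C.cycles ^ 2 * n) := by
        gcongr
        exact Nat.div_mul_le_self n L

/- A factor `2` is lost in rounding `log (2 * δ) / log ε` down to `L`, and another in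
replacing `log (2 * δ)` by `log δ`. -/
theorem exists_le_pow_div_two_and_log_div_log_le {δ : ℝ} (hε0 : 0 < ε) (hε1 : ε < 1) (hδ0 : 0 < δ)
    (hδ : δ ≤ min (1 / 4) (ε / 2)) :
    ∃ L : ℕ, 0 < L ∧ δ ≤ ε ^ L / 2 ∧ Real.log δ / Real.log ε ≤ 4 * L := by
  obtain ⟨hδ4, hδε⟩ := le_min_iff.1 hδ
  have hlogε : Real.log ε < 0 := Real.log_neg hε0 hε1
  have hlog_le : Real.log (2 * δ) ≤ Real.log ε := Real.log_le_log (by positivity) (by linarith)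
  have hlog_half : 2 * Real.log (2 * δ) ≤ Real.log δ := by
    rw [← Nat.cast_two, ← Real.log_pow]
    exact Real.log_le_log (by positivity) (by norm_num; nlinarith)
  set a := Real.log (2 * δ) / Real.log ε
  have ha : 1 ≤ a := (one_le_div_of_neg hlogε).2 hlog_le
  have hfloor : a / 2 < ⌊a⌋₊ := Nat.div_two_lt_floor ha
  refine ⟨⌊a⌋₊, Nat.floor_pos.2 ha, ?_, ?_⟩
  · rw [le_div_iff₀' two_pos, ← Real.log_le_log_iff (by positivity) (by positivity), Real.log_pow,
      ← le_div_iff_of_neg hlogε]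
    exact Nat.floor_le (zero_le_one.trans ha)
  · calc Real.log δ / Real.log ε ≤ 2 * Real.log (2 * δ) / Real.log ε :=
          div_le_div_of_nonpos_of_le hlogε.le hlog_half
      _ = 4 * (a / 2) := by ring
      _ ≤ 4 * ⌊a⌋₊ := by gcongr

theorem sq_outputs_mul_log_div_log_le (hε0 : 0 < ε) (hε1 : ε < 1) {δ : ℝ}
    (hδ : δ ≤ min (1 / 4) (ε / 2)) (hP : blockErrorProb ε enc C.compute < δ) :
    k ^ 2 * (Real.log δ / Real.log ε) ≤ 576 * (C.area * C.cycles ^ 2 * n) := by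
  obtain ⟨L, hL, hδL, hlog⟩ := exists_le_pow_div_two_and_log_div_log_le hε0 hε1
    ((blockErrorProb_nonneg hε0.le hε1.le).trans_lt hP) hδ
  have hbits : (k ^ 2 * L : ℝ) ≤ 144 * (C.area * C.cycles ^ 2 * n) :=
    mod_cast sq_outputs_mul_le hε0.le hε1.le hL (hP.trans_le hδL)
  calc (k : ℝ) ^ 2 * (Real.log δ / Real.log ε) ≤ k ^ 2 * (4 * L) := by gcongr
    _ = 4 * ((k : ℝ) ^ 2 * L) := by ring
    _ ≤ 4 * (144 * ((C.area : ℝ) * C.cycles ^ 2 * n)) := by gcongr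
    _ = 576 * ((C.area : ℝ) * C.cycles ^ 2 * n) := by ring

theorem sq_outputs_mul_log_div_le_area_mul_sq_cycles (hε0 : 0 < ε) (hε1 : ε < 1) {δ : ℝ}
    (hδ : δ ≤ min (1 / 4) (ε / 2)) (hP : blockErrorProb ε enc C.compute < δ) :
    k ^ 2 * Real.log δ / (n * Real.log ε) ≤ 576 * (C.area * C.cycles ^ 2) := by
  rcases n.eq_zero_or_pos with rfl | hn
  · simp only [Nat.cast_zero, zero_mul, div_zero]
    positivity
  · rw [mul_div_mul_comm, div_mul_eq_mul_div, div_le_iff₀ (mod_cast hn), mul_assoc]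
    exact sq_outputs_mul_log_div_log_le hε0 hε1 hδ hP

theorem sqrt_log_div_log_mul_outputs_le_energy (hε0 : 0 < ε) (hε1 : ε < 1) {δ : ℝ}
    (hδ : δ ≤ min (1 / 4) (ε / 2)) (hP : blockErrorProb ε enc C.compute < δ) :
    √(Real.log δ / Real.log ε) * k ≤ 24 * C.energy := by
  have hδ0 : 0 < δ := (blockErrorProb_nonneg hε0.le hε1.le).trans_lt hP
  have hlog : 0 ≤ Real.log δ / Real.log ε := by
    refine div_nonneg_of_nonpos (Real.log_nonpos hδ0.le ?_) (Real.log_nonpos hε0.le hε1.le)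
    linarith [hδ.trans (min_le_left _ _)]
  have harea : (n : ℝ) ≤ C.area := mod_cast C.inputs_le_area
  refine le_of_sq_le_sq ?_ (by positivity)
  calc (√(Real.log δ / Real.log ε) * k : ℝ) ^ 2 = k ^ 2 * (Real.log δ / Real.log ε) := by
        rw [mul_pow, Real.sq_sqrt hlog, mul_comm]
    _ ≤ 576 * ((C.area : ℝ) * C.cycles ^ 2 * n) := sq_outputs_mul_log_div_log_le hε0 hε1 hδ hP
    _ ≤ 576 * ((C.area : ℝ) * C.cycles ^ 2 * C.area) := by gcongr
    _ = (24 * (C.energy : ℝ)) ^ 2 := by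
        rw [FullyParallelCircuit.energy, Nat.cast_mul]
        ring

end Decoder

section Constants

theorem mul_le_of_mul_le_one {b c x y : ℝ} (hc : 0 ≤ c) (hcb : c * b ≤ 1) (hy : 0 ≤ y)
    (h : x ≤ b * y) : c * x ≤ y :=
  calc c * x ≤ c * (b * y) := mul_le_mul_of_nonneg_left h hc
    _ = c * b * y := (mul_assoc c b y).symm
    _ ≤ y := mul_le_of_le_one_left hy hcb

theorem log_two_le_one : Real.log 2 ≤ 1 := by linarith [Real.log_two_lt_d9]

theorem sqrt_two_sub_one_nonneg : 0 ≤ √2 - 1 := sub_nonneg.2 (Real.one_le_sqrt.2 one_le_two)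

theorem sqrt_two_sub_one_le_half : √2 - 1 ≤ 1 / 2 := by
  have : √2 ≤ 3 / 2 := Real.sqrt_le_iff.2 (by norm_num)
  linarith

theorem energy_constant_mul_le {x y : ℝ} (hy : 0 ≤ y) (h : x ≤ 24 * y) :
    √(Real.log 2) * (√2 - 1) / (16 * √2) * x ≤ y := by
  have hsqrt := sqrt_two_sub_one_nonneg
  refine mul_le_of_mul_le_one (by positivity) ?_ hy h
  calc √(Real.log 2) * (√2 - 1) / (16 * √2) * 24 ≤ 1 * (1 / 2) / (16 * 1) * 24 := by
        gcongr
        · exact Real.sqrt_le_one.2 log_two_le_one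
        · exact sqrt_two_sub_one_le_half
        · exact sub_nonneg.1 hsqrt
    _ ≤ 1 := by norm_num

theorem area_time_constant_mul_le {x y : ℝ} (hy : 0 ≤ y) (h : x ≤ 576 * y) :
    Real.log 2 * (√2 - 1) ^ 2 / 512 * x ≤ y := by
  refine mul_le_of_mul_le_one (by positivity) ?_ hy h
  calc Real.log 2 * (√2 - 1) ^ 2 / 512 * 576 ≤ 1 * (1 / 2) ^ 2 / 512 * 576 := by
        gcongr
        · exact log_two_le_one
        · exact sqrt_two_sub_one_nonneg
        · exact sqrt_two_sub_one_le_half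
    _ ≤ 1 := by norm_num

end Constants

end Thompson

theorem theorem1_general (ε : ℝ) (hε0 : 0 < ε) (hε1 : ε < 1) (f : ℕ → ℝ)
    (hf : ∀ᶠ n in atTop, f n ≤ min (1 / 4) (ε / 2))
    (D : Thompson.DecodingScheme) (hD : D.IsDecodingSchemeFor ε f) :
    ∀ᶠ i in atTop,
      √(Real.log (f (D.n i)) / Real.log ε) * (D.k i : ℝ) ≤ 24 * ((D.decoder i).energy : ℝ) ∧
      (D.k i : ℝ) ^ 2 * Real.log (f (D.n i)) / ((D.n i : ℝ) * Real.log ε) ≤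
        576 * (((D.decoder i).area : ℝ) * ((D.decoder i).cycles : ℝ) ^ 2) := by
  filter_upwards [hD, D.n_strictMono.tendsto_atTop.eventually hf] with i hP hδ
  exact ⟨Thompson.sqrt_log_div_log_mul_outputs_le_energy hε0 hε1 hδ hP,
    Thompson.sq_outputs_mul_log_div_le_area_mul_sq_cycles hε0 hε1 hδ hP⟩

theorem theorem1 (ε : ℝ) (hε0 : 0 < ε) (hε1 : ε < 1)
    (f : ℕ → ℝ) (hf_pos : ∀ n, 1 ≤ n → 0 < f n)
    (hf_anti : AntitoneOn f (Set.Ici 1)) (hf_lim : Tendsto f atTop (𝓝 0))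
    (hf_sub : Thompson.Sublinear fun n => -Real.log (f n))
    (D : Thompson.DecodingScheme) (hD : D.IsDecodingSchemeFor ε f) :
    ∀ᶠ i in atTop,
      Real.sqrt (Real.log 2) * (Real.sqrt 2 - 1) / (16 * Real.sqrt 2) *
          Real.sqrt (Real.log (f (D.n i)) / Real.log ε) * (D.k i : ℝ)
        ≤ ((D.decoder i).energy : ℝ) ∧
      Real.log 2 * (Real.sqrt 2 - 1) ^ 2 / 512 *
          ((D.k i : ℝ) ^ 2 * Real.log (f (D.n i)) / ((D.n i : ℝ) * Real.log ε))
        ≤ ((D.decoder i).area : ℝ) * ((D.decoder i).cycles : ℝ) ^ 2 := by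
  filter_upwards [theorem1_general ε hε0 hε1 f
    (hf_lim.eventually (eventually_le_nhds (by positivity))) D hD] with i ⟨henergy, harea⟩
  exact ⟨(mul_assoc ..).trans_le (Thompson.energy_constant_mul_le (Nat.cast_nonneg _) henergy),
    Thompson.area_time_constant_mul_le (by positivity) harea⟩
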